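/- Identify $\mathbb R^2$ with $\mathbb C$ by $z=x_1+ix_2$. Fix $E>0$. For $\lambda\in\mathbb C'=\{\lambda\in\mathbb C:\lambda\neq 0,\ |\lambda|\neq 1\}$ put $$k_1(\lambda)=\Big(\lambda+\frac1\lambda\Big)\frac{\sqrt E}{2},\qquad k_2(\lambda)=\Big(\frac1\lambda-\lambda\Big)\frac{i\sqrt E}{2},$$ and let $$g(z,k(\lambda))=-\frac1{(2\pi)^2}\int_{\mathbb R^2}\frac{e^{i\xi\cdot x}}{|\xi|^2+2k(\lambda)\cdot\xi}\,d\xi ,\qquad z\neq 0,$$ be Faddeev's Green function, where the (not absolutely convergent) integral is understood as the limit as $\varepsilon\to0^+$ of the integrals with the additional factor $e^{-\varepsilon|\xi|^2}$ in the integrand. For a function $v:\mathbb C\to\mathbb C$, a point $\lambda\in\mathbb C'$ is called exceptional if the Lippmann–Schwinger equation $$\mu(z)=1+\int_{\mathbb R^2}g(z-z',k(\lambda))\,v(z')\,\mu(z')\,dx_1'dx_2'$$ (understood for almost every $z$, with an absolutely convergent integral) does not have exactly one solution $\mu\in L^\infty(\mathbb R^2)$. Lemma 2.1. Let $1<p\le\infty$.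 For all $M,R\ge 0$ there exists a number $A>1$, depending only on $p$, $M$, $R$ (and on the fixed energy $E$), such that for every (complex-valued) $v\in L^p(\mathbb R^2)$ that satisfies $\|v\|_{L^p}\le M$ and vanishes almost everywhere outside some closed disc of radius $R$ with arbitrary centre, all exceptional points $\lambda$ lie in the ring $$D=\{\lambda\in\mathbb C:\ A^{-1}<|\lambda|<A\}.$$ -/

import Mathlib

open MeasureTheory Filter Topology
open scoped ENNReal

namespace Faddeev

noncomputable section

/-- First component of the complex momentum: `k₁ = (λ + 1/λ) √E / 2`. -/
def k₁ (E : ℝ) (l : ℂ) : ℂ := (l + 1 / l) * ((Real.sqrt E : ℂ) / 2)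

/-- Second component of the complex momentum: `k₂ = (1/λ - λ) i √E / 2`. -/
def k₂ (E : ℝ) (l : ℂ) : ℂ := (1 / l - l) * (Complex.I * (Real.sqrt E : ℂ) / 2)

/-- The symbol `|ξ|² + 2 k(λ) · ξ`, where `ξ = (ξ₁, ξ₂) ∈ ℝ²` is written as `ξ₁ + i ξ₂ ∈ ℂ`. -/
def symbol (E : ℝ) (l ξ : ℂ) : ℂ :=
  ((‖ξ‖ ^ 2 : ℝ) : ℂ) + 2 * (k₁ E l * (ξ.re : ℂ) + k₂ E l * (ξ.im : ℂ))

/-- The Gauss means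
`-(2π)⁻² ∫_{ℝ²} exp(-ε|ξ|²) exp(i ξ·x) / (|ξ|² + 2 k(λ)·ξ) dξ`, where `z = x₁ + i x₂`. -/
def greenMean (E : ℝ) (l : ℂ) (ε : ℝ) (z : ℂ) : ℂ :=
  -(1 / (2 * (Real.pi : ℂ)) ^ 2) *
    ∫ ξ : ℂ, Complex.exp (-((ε * ‖ξ‖ ^ 2 : ℝ) : ℂ)) *
      (Complex.exp (Complex.I * ((ξ.re * z.re + ξ.im * z.im : ℝ) : ℂ)) / symbol E l ξ)

/-- Faddeev's Green function
`g(z, k(λ)) = -(2π)⁻² ∫_{ℝ²} exp(i ξ·x) / (|ξ|² + 2 k(λ)·ξ) dξ`.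
The integrand decays only like `|ξ|⁻²`, so this inverse Fourier transform does not converge
absolutely; as usual it is read as the limit of its Gauss means. For `λ ≠ 0`, `|λ| ≠ 1`
the limit exists at every `z ≠ 0`, and it is the function that represents the
inverse Fourier transform in the sense of tempered distributions. -/
def g (E : ℝ) (l z : ℂ) : ℂ :=
  limUnder (𝓝[>] (0 : ℝ)) (fun ε : ℝ => greenMean E l ε z)

/-- `μ ∈ L^∞` solves `μ(z) = 1 + ∫ g(z - z', k(λ)) v(z') μ(z') dx₁' dx₂'`
(for almost every `z`, the integral being absolutely convergent). -/
def IsSolution (E : ℝ) (v : ℂ → ℂ) (l : ℂ) (μ : Lp ℂ ∞ (volume : Measure ℂ)) : Prop :=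
  ∀ᵐ z : ℂ, Integrable (fun w : ℂ => g E l (z - w) * v w * μ w) ∧
    μ z = 1 + ∫ w : ℂ, g E l (z - w) * v w * μ w

/-- `λ ∈ ℂ' = {λ ≠ 0, |λ| ≠ 1}` is exceptional for the potential `v` at energy `E` if the
Lippmann-Schwinger equation for `μ` is not uniquely solvable in `L^∞`. -/
def IsExceptional (E : ℝ) (v : ℂ → ℂ) (l : ℂ) : Prop :=
  l ≠ 0 ∧ ‖l‖ ≠ 1 ∧ ¬ ∃! μ : Lp ℂ ∞ (volume : Measure ℂ), IsSolution E v l μ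

end

end Faddeev

/-! As `λ` tends to `0` or to infinity, the operator with kernel `g(z - w) v(w)` becomes small on
`L^∞`. The Lippmann–Schwinger map is then a contraction with exactly one fixed point
(`existsUnique_integral_equation`).

The smallness comes from `‖g(z)‖ ≤ C ‖S‖^(-d) ‖z‖^(-d)` with `0 < d < 1`, `S = pole E l` and `‖S‖ =
√E (|λ| + 1/|λ|)` (`norm_g_le`). Away from `|λ| = 1` the symbol is bounded below by `‖ξ‖ ‖ξ + S‖ /
2` (`norm_mul_norm_add_pole_le`), so its reciprocal decays like `‖ξ‖^(-2)` and barely fails to be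
integrable. Shifting `ξ` by half a period `h` of the character, `‖h‖ = π / ‖z‖`, flips the sign of
the character and replaces the reciprocal by half its increment (`greenMean_eq_integral_sub`).
Uniformly in the Gaussian parameter, that increment is at most `‖h‖^d` times a function whose
integral is a multiple of `‖S‖^(-d)` (`norm_dampedInv_sub_le`, `integrable_twoPoleMajorant`). This
gives both the existence of the limit `g` and its bound.

Hölder's inequality, with `d` small relative to the exponent conjugate to `p`, bounds `∫ ‖z -
w‖^(-d) ‖v w‖ dw` uniformly in `z` and in the centre of the disc (`lintegral_norm_rpow_mul_le`). -/

namespace Faddeev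

/-! ### Scalar estimates for increments of a damped reciprocal -/

/-- The reciprocals of two complex numbers that are bounded below by `m * M` and `m' * M'`
(the products of the distances to two poles at distance `s`), with damping factors `e`, `e'`. -/
theorem norm_damped_inv_sub_le {m M m' M' s t e e' : ℝ} {P P' : ℂ} (hm : 0 < m) (hM : m ≤ M)
    (hm' : 0 < m') (hM' : m' ≤ M') (ht : 0 ≤ t) (hs : s ≤ m + M)
    (hs1 : M' ≤ m' + s) (hP : m * M ≤ 2 * ‖P‖) (hP' : m' * M' ≤ 2 * ‖P'‖)
    (hle : m * M ≤ m' * M') (hPP : ‖P' - P‖ ≤ t * (M + M' + s))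
    (he0 : 0 ≤ e) (he1 : e ≤ 1) (he0' : 0 ≤ e') (he1' : e' ≤ 1)
    (hee : |e - e'| ≤ 3 * t * (1 / m + 1 / m')) :
    ‖(e : ℂ) / P - (e' : ℂ) / P'‖ ≤ 72 * min 1 (t / m) / (m * M) := by
  have hMp : 0 < M := hm.trans_le hM
  have hMp' : 0 < M' := hm'.trans_le hM'
  have hQ : 0 < m * M := by positivity
  have hQ' : 0 < m' * M' := by positivity
  have hPpos : 0 < ‖P‖ := by linarith
  have hPpos' : 0 < ‖P'‖ := by linarith
  have hP0 : P ≠ 0 := norm_pos_iff.1 hPpos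
  have hP0' : P' ≠ 0 := norm_pos_iff.1 hPpos'
  have hi : 1 / ‖P‖ ≤ 2 / (m * M) := by
    rw [div_le_div_iff₀ hPpos hQ]; linarith
  have hi' : 1 / ‖P'‖ ≤ 2 / (m' * M') := by
    rw [div_le_div_iff₀ hPpos' hQ']; linarith
  have hi'' : 2 / (m' * M') ≤ 2 / (m * M) := by gcongr
  have hne : ‖(e : ℂ)‖ ≤ 1 := by simpa [abs_of_nonneg he0] using he1
  have hne' : ‖(e' : ℂ)‖ ≤ 1 := by simpa [abs_of_nonneg he0'] using he1'
  -- If `m' < m / 3`, then `s ≤ 2 * M` and `M' ≤ m' + s` give `m' * M' ≤ (7 / 9) * (m * M)`, against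
  -- `hle`.
  have hmm : m ≤ 3 * m' := by
    by_contra! hc
    have h1 : s ≤ 2 * M := by linarith
    have h2 : m' * M' ≤ m' * (m' + s) := by gcongr
    have h3 : m' * (m' + s) ≤ m / 3 * (M / 3 + 2 * M) := by
      gcongr <;> linarith
    nlinarith
  have hA : ‖(e : ℂ) / P - (e' : ℂ) / P'‖ ≤ 4 / (m * M) := by
    calc _ ≤ ‖(e : ℂ) / P‖ + ‖(e' : ℂ) / P'‖ := norm_sub_le _ _
      _ ≤ 1 / ‖P‖ + 1 / ‖P'‖ := by
        rw [norm_div, norm_div]; gcongr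
      _ ≤ 2 / (m * M) + 2 / (m * M) := add_le_add hi (hi'.trans hi'')
      _ = _ := by ring
  have hB1 : ‖P' - P‖ / (‖P‖ * ‖P'‖) ≤ 48 * (t / m) / (m * M) := by
    have h1 : M + M' + s ≤ 3 * (M + M') := by linarith
    have h2 : ‖P' - P‖ / (‖P‖ * ‖P'‖) = ‖P' - P‖ * ((1 / ‖P‖) * (1 / ‖P'‖)) := by
      field_simp
    rw [h2]
    calc _ ≤ (t * (3 * (M + M'))) * ((2 / (m * M)) * (2 / (m' * M'))) := by
          gcongr
          exact hPP.trans (by gcongr)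
      -- The factor `M + M'` cancels one far distance in each summand, so only near distances remain
      -- as extra denominators.
      _ = 12 * t * (1 / m * (1 / (m' * M')) + 1 / m' * (1 / (m * M))) := by
          field_simp; ring
      _ ≤ 12 * t * (1 / m * (1 / (m * M)) + 3 / m * (1 / (m * M))) := by
          gcongr ?_ * (?_ * ?_ + ?_ * ?_)
          · exact one_div_le_one_div_of_le hQ hle
          · rw [div_le_div_iff₀ hm' hm]; linarith
      _ = _ := by field_simp; ring
  have hB2 : |e - e'| * (1 / ‖P'‖) ≤ 24 * (t / m) / (m * M) := by
    calc _ ≤ (3 * t * (1 / m + 3 / m)) * (2 / (m * M)) := by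
          gcongr ?_ * ?_
          · refine hee.trans ?_
            have h1 : 1 / m' ≤ 3 / m := by rw [div_le_div_iff₀ hm' hm]; linarith
            gcongr
          · exact hi'.trans hi''
      _ = _ := by field_simp; ring
  have hB : ‖(e : ℂ) / P - (e' : ℂ) / P'‖ ≤ 72 * (t / m) / (m * M) := by
    have h1 : (e : ℂ) / P - (e' : ℂ) / P'
        = (e : ℂ) * ((P' - P) / (P * P')) + ((e - e' : ℝ) : ℂ) / P' := by
      push_cast; field_simp; ring
    rw [h1]
    calc _ ≤ 1 * (‖P' - P‖ / (‖P‖ * ‖P'‖)) + |e - e'| * (1 / ‖P'‖) := by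
          refine (norm_add_le _ _).trans (add_le_add ?_ (le_of_eq ?_))
          · rw [norm_mul, norm_div, norm_mul]; gcongr
          · rw [norm_div, Complex.norm_real, Real.norm_eq_abs]; ring
      _ ≤ 48 * (t / m) / (m * M) + 24 * (t / m) / (m * M) := by
          rw [one_mul]; exact add_le_add hB1 hB2
      _ = _ := by ring
  rcases le_total 1 (t / m) with h | h
  · rw [min_eq_left h]; refine hA.trans ?_; gcongr; norm_num
  · rw [min_eq_right h]; exact hB

theorem min_one_le_rpow {a d : ℝ} (ha : 0 ≤ a) (hd0 : 0 < d) (hd1 : d ≤ 1) :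
    min 1 a ≤ a ^ d := by
  rcases le_total 1 a with h | h
  · exact (min_le_left _ _).trans (Real.one_le_rpow h hd0.le)
  · exact (min_le_right _ _).trans (by
      simpa using Real.rpow_le_rpow_of_exponent_ge' ha h hd0.le hd1)

/-- The radial majorant. -/
noncomputable def majorant (d s r : ℝ) : ℝ := r ^ (-1 - d) / (r + s)

theorem majorant_nonneg {d s r : ℝ} (hr : 0 ≤ r) (hs : 0 ≤ s) : 0 ≤ majorant d s r := by
  unfold majorant; positivity

/-- Interpolation `min 1 a ≤ a ^ d` extracts the power of `t`. The far distance satisfies `m + s ≤ 3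
* M`, because `s ≤ m + M ≤ 2 * M`. -/
theorem min_one_div_le_majorant {m M s t d : ℝ} (hm : 0 < m) (hM : m ≤ M) (ht : 0 ≤ t)
    (hs0 : 0 < s) (hs : s ≤ m + M) (hd0 : 0 < d) (hd1 : d ≤ 1) :
    min 1 (t / m) / (m * M) ≤ 3 * t ^ d * majorant d s m := by
  have hMp : 0 < M := hm.trans_le hM
  have h1 : min 1 (t / m) ≤ t ^ d * m ^ (-d) := by
    refine (min_one_le_rpow (by positivity) hd0 hd1).trans (le_of_eq ?_)
    rw [Real.div_rpow ht hm.le, Real.rpow_neg hm.le, div_eq_mul_inv]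
  have h2 : 1 / (m * M) ≤ 3 * (m⁻¹ / (m + s)) := by
    have : 3 * (m⁻¹ / (m + s)) = 3 / (m * (m + s)) := by field_simp
    rw [this, div_le_div_iff₀ (by positivity) (by positivity)]
    nlinarith
  have h3 : majorant d s m = m ^ (-d) * (m⁻¹ / (m + s)) := by
    rw [majorant, show -1 - d = -d + -1 by ring, Real.rpow_add hm, Real.rpow_neg_one]; ring
  calc _ = min 1 (t / m) * (1 / (m * M)) := by ring
    _ ≤ (t ^ d * m ^ (-d)) * (3 * (m⁻¹ / (m + s))) := by gcongr
    _ = _ := by rw [h3]; ring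

/-- The bound is free of `ε` because `u * exp (-u) ≤ 1` at `u = ε * a ^ 2` absorbs the factor `ε`.
If the larger radius is at least twice the smaller, the trivial bound `1` suffices. -/
theorem abs_exp_neg_sq_sub_le {ε x y t : ℝ} (hε : 0 ≤ ε) (hx : 0 < x) (hy : 0 < y)
    (ht : |x - y| ≤ t) :
    |Real.exp (-(ε * x ^ 2)) - Real.exp (-(ε * y ^ 2))| ≤ 3 * t * (1 / x + 1 / y) := by
  have key : ∀ a b : ℝ, 0 < a → a ≤ b →
      |Real.exp (-(ε * a ^ 2)) - Real.exp (-(ε * b ^ 2))| ≤ 3 * (b - a) * (1 / a) := by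
    intro a b ha hab
    have hmono : Real.exp (-(ε * b ^ 2)) ≤ Real.exp (-(ε * a ^ 2)) := by gcongr
    rw [abs_of_nonneg (by linarith)]
    rcases le_total (2 * a) b with h | h
    · have h1 : Real.exp (-(ε * a ^ 2)) ≤ 1 := Real.exp_le_one_iff.2 (by nlinarith [sq_nonneg a])
      have h2 : 1 ≤ (b - a) * (1 / a) := by
        rw [mul_one_div, le_div_iff₀ ha]; linarith
      nlinarith [Real.exp_pos (-(ε * b ^ 2))]
    · have h1 : Real.exp (-(ε * b ^ 2))
          = Real.exp (-(ε * a ^ 2)) * Real.exp (-(ε * (b ^ 2 - a ^ 2))) := by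
        rw [← Real.exp_add]; ring_nf
      have h2 : 1 - Real.exp (-(ε * (b ^ 2 - a ^ 2))) ≤ ε * (b ^ 2 - a ^ 2) := by
        linarith [Real.add_one_le_exp (-(ε * (b ^ 2 - a ^ 2)))]
      have h3 : (ε * a ^ 2) * Real.exp (-(ε * a ^ 2)) ≤ 1 := by
        rw [Real.exp_neg, ← div_eq_mul_inv, div_le_one (Real.exp_pos _)]
        linarith [Real.add_one_le_exp (ε * a ^ 2)]
      calc _ = Real.exp (-(ε * a ^ 2)) * (1 - Real.exp (-(ε * (b ^ 2 - a ^ 2)))) := by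
            rw [h1]; ring
        _ ≤ Real.exp (-(ε * a ^ 2)) * (ε * (b ^ 2 - a ^ 2)) := by gcongr
        _ ≤ Real.exp (-(ε * a ^ 2)) * (ε * (3 * a * (b - a))) := by
            gcongr; nlinarith
        _ = 3 * (b - a) * (1 / a) * ((ε * a ^ 2) * Real.exp (-(ε * a ^ 2))) := by
            field_simp
        _ ≤ 3 * (b - a) * (1 / a) * 1 := by
            have : 0 ≤ b - a := by linarith
            gcongr
        _ = _ := by ring
  have ht0 : 0 ≤ t := (abs_nonneg _).trans ht
  rcases le_total x y with h | h
  · refine (key x y hx h).trans ?_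
    have : y - x ≤ t := by rw [abs_sub_comm] at ht; exact (le_abs_self _).trans ht
    gcongr
    linarith [one_div_pos.2 hy]
  · rw [abs_sub_comm]
    refine (key y x hy h).trans ?_
    have : x - y ≤ t := (le_abs_self _).trans ht
    gcongr
    linarith [one_div_pos.2 hx]

/-! ### The symbol and its two zeros -/

/-- The second pole `-√E (λ + 1 / conj λ)` of the symbol, up to sign. -/
noncomputable def pole (E : ℝ) (l : ℂ) : ℂ :=
  ((Real.sqrt E * (1 + 1 / ‖l‖ ^ 2) : ℝ) : ℂ) * l

theorem symbol_re_im (E : ℝ) (l ξ : ℂ) :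
    symbol E l ξ = ((‖ξ‖ ^ 2 + Real.sqrt E * (1 + 1 / ‖l‖ ^ 2) * (ξ.re * l.re + ξ.im * l.im) : ℝ) : ℂ)
      - ((Real.sqrt E * (1 - 1 / ‖l‖ ^ 2) * (ξ.im * l.re - ξ.re * l.im) : ℝ) : ℂ) * Complex.I := by
  have hinv : 1 / l = ((1 / ‖l‖ ^ 2 * l.re : ℝ) : ℂ)
      - ((1 / ‖l‖ ^ 2 * l.im : ℝ) : ℂ) * Complex.I := by
    rw [Complex.sq_norm, one_div, Complex.inv_def, one_div]
    apply Complex.ext <;>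
      simp only [Complex.mul_re, Complex.mul_im, Complex.conj_re, Complex.conj_im, Complex.sub_re,
        Complex.sub_im, Complex.ofReal_re, Complex.ofReal_im, Complex.I_re, Complex.I_im] <;> ring
  rw [symbol, k₁, k₂, hinv]
  generalize 1 / ‖l‖ ^ 2 = r
  rw [show (Real.sqrt E : ℂ) / 2 = ((Real.sqrt E / 2 : ℝ) : ℂ) by push_cast; rfl,
    show Complex.I * (Real.sqrt E : ℂ) / 2 = Complex.I * ((Real.sqrt E / 2 : ℝ) : ℂ) by
      push_cast; ring]
  generalize ‖ξ‖ ^ 2 = n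
  apply Complex.ext <;>
    simp only [Complex.mul_re, Complex.mul_im, Complex.sub_re, Complex.add_re, Complex.add_im,
      Complex.sub_im, Complex.ofReal_re, Complex.ofReal_im, Complex.I_re, Complex.I_im,
      Complex.re_ofNat, Complex.im_ofNat] <;> ring

/-- The symbol and `conj ξ * (ξ + pole E l)` have the same real part. Up to sign, their imaginary
parts differ only in the factor `1 - 1 / ‖l‖ ^ 2` in place of `1 + 1 / ‖l‖ ^ 2`, and the hypothesis
makes these factors comparable. -/
theorem norm_mul_norm_add_pole_le (E : ℝ) {l : ℂ}
    (h : 1 + 1 / ‖l‖ ^ 2 ≤ 2 * |1 - 1 / ‖l‖ ^ 2|) (ξ : ℂ) :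
    ‖ξ‖ * ‖ξ + pole E l‖ ≤ 2 * ‖symbol E l ξ‖ := by
  have hb : (1 + 1 / ‖l‖ ^ 2) ^ 2 ≤ 4 * (1 - 1 / ‖l‖ ^ 2) ^ 2 := by
    rw [← sq_abs (1 - 1 / ‖l‖ ^ 2)]
    have : 0 ≤ 1 + 1 / ‖l‖ ^ 2 := by positivity
    nlinarith
  rw [symbol_re_im, pole]
  generalize 1 - 1 / ‖l‖ ^ 2 = β at *
  generalize 1 + 1 / ‖l‖ ^ 2 = α at *
  generalize Real.sqrt E = q
  refine abs_le_of_sq_le_sq' ?_ (by positivity) |>.2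
  simp only [mul_pow, Complex.sq_norm, Complex.normSq_apply]
  simp
  generalize ξ.re = a
  generalize ξ.im = b
  generalize l.re = c
  generalize l.im = d
  nlinarith [mul_nonneg (mul_nonneg (sq_nonneg q) (sq_nonneg (b * c - a * d))) (sub_nonneg.2 hb),
    sq_nonneg (a * a + b * b + q * α * (a * c + b * d))]

theorem norm_pole (E : ℝ) {l : ℂ} (hl : l ≠ 0) :
    ‖pole E l‖ = Real.sqrt E * (‖l‖ + 1 / ‖l‖) := by
  have : 0 < ‖l‖ := norm_pos_iff.2 hl
  rw [pole, norm_mul, Complex.norm_real, Real.norm_eq_abs, abs_of_nonneg (by positivity)]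
  field_simp

theorem norm_symbol_add_sub_le (E : ℝ) (l ξ h : ℂ) :
    ‖symbol E l (ξ + h) - symbol E l ξ‖ ≤ ‖h‖ * (‖ξ‖ + ‖ξ + h‖ + ‖pole E l‖) := by
  have e1 : symbol E l (ξ + h) - symbol E l ξ = ((‖ξ + h‖ ^ 2 - ‖ξ‖ ^ 2 : ℝ) : ℂ)
      + (((Real.sqrt E * (1 + 1 / ‖l‖ ^ 2) * (h.re * l.re + h.im * l.im) : ℝ) : ℂ)
      - ((Real.sqrt E * (1 - 1 / ‖l‖ ^ 2) * (h.im * l.re - h.re * l.im) : ℝ) : ℂ) * Complex.I) := by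
    rw [symbol_re_im, symbol_re_im]
    simp only [Complex.add_re, Complex.add_im]
    push_cast; ring
  have e2 : ‖((‖ξ + h‖ ^ 2 - ‖ξ‖ ^ 2 : ℝ) : ℂ)‖ ≤ ‖h‖ * (‖ξ‖ + ‖ξ + h‖) := by
    rw [Complex.norm_real, Real.norm_eq_abs,
      show ‖ξ + h‖ ^ 2 - ‖ξ‖ ^ 2 = (‖ξ + h‖ - ‖ξ‖) * (‖ξ‖ + ‖ξ + h‖) by ring, abs_mul,
      abs_of_nonneg (a := ‖ξ‖ + ‖ξ + h‖) (by positivity)]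
    gcongr
    simpa using abs_norm_sub_norm_le (ξ + h) ξ
  have e3 : ‖((Real.sqrt E * (1 + 1 / ‖l‖ ^ 2) * (h.re * l.re + h.im * l.im) : ℝ) : ℂ)
      - ((Real.sqrt E * (1 - 1 / ‖l‖ ^ 2) * (h.im * l.re - h.re * l.im) : ℝ) : ℂ) * Complex.I‖
      ≤ ‖h‖ * ‖pole E l‖ := by
    have hb : (1 - 1 / ‖l‖ ^ 2) ^ 2 ≤ (1 + 1 / ‖l‖ ^ 2) ^ 2 := by
      have : 0 ≤ 1 / ‖l‖ ^ 2 := by positivity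
      nlinarith
    rw [pole]
    generalize 1 - 1 / ‖l‖ ^ 2 = β at *
    generalize 1 + 1 / ‖l‖ ^ 2 = α at *
    generalize Real.sqrt E = q
    refine abs_le_of_sq_le_sq' ?_ (by positivity) |>.2
    simp only [mul_pow, Complex.sq_norm, Complex.normSq_apply]
    simp
    generalize h.re = a
    generalize h.im = b
    generalize l.re = c
    generalize l.im = d
    nlinarith [mul_nonneg (mul_nonneg (sq_nonneg q) (sq_nonneg (b * c - a * d))) (sub_nonneg.2 hb)]
  rw [e1]
  refine (norm_add_le _ _).trans ((add_le_add e2 e3).trans (le_of_eq (by ring)))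

/-- The damped reciprocal of the symbol. -/
noncomputable def dampedInv (E : ℝ) (l : ℂ) (ε : ℝ) (ξ : ℂ) : ℂ :=
  (Real.exp (-(ε * ‖ξ‖ ^ 2)) : ℂ) / symbol E l ξ

/-- The integrable majorant of the increments of the damped reciprocal of the symbol. -/
noncomputable def twoPoleMajorant (d : ℝ) (S ξ : ℂ) : ℝ :=
  majorant d ‖S‖ ‖ξ‖ + majorant d ‖S‖ ‖ξ + S‖

theorem majorant_min_le {d s x y : ℝ} (hs : 0 ≤ s) (hx : 0 ≤ x) (hy : 0 ≤ y) :
    majorant d s (min x y) ≤ majorant d s x + majorant d s y := by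
  have h1 := majorant_nonneg (d := d) hx hs
  have h2 := majorant_nonneg (d := d) hy hs
  rcases min_choice x y with h | h <;> rw [h] <;> linarith

/-- The scalar estimate applies with `m`, `M` the distances from a point to its nearer and farther
zero. The constant is `216 = 72 * 3`. -/
theorem norm_dampedInv_sub_le {E : ℝ} {l : ℂ} (hE : 0 < E) (hl : l ≠ 0)
    (hl2 : 1 + 1 / ‖l‖ ^ 2 ≤ 2 * |1 - 1 / ‖l‖ ^ 2|) {ε d : ℝ} (hε : 0 ≤ ε) (hd0 : 0 < d)
    (hd1 : d ≤ 1) {ξ h : ℂ} (h1 : ξ ≠ 0) (h2 : ξ + pole E l ≠ 0) (h3 : ξ + h ≠ 0)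
    (h4 : ξ + h + pole E l ≠ 0) :
    ‖dampedInv E l ε ξ - dampedInv E l ε (ξ + h)‖ ≤
      216 * ‖h‖ ^ d * (twoPoleMajorant d (pole E l) ξ + twoPoleMajorant d (pole E l) (ξ + h)) := by
  set S := pole E l with hS
  have hs0 : 0 < ‖S‖ := by rw [hS, norm_pole E hl]; have := Real.sqrt_pos.2 hE; positivity
  have aux : ∀ η k : ℂ, η ≠ 0 → η + S ≠ 0 → η + k ≠ 0 → η + k + S ≠ 0 →
      ‖η‖ * ‖η + S‖ ≤ ‖η + k‖ * ‖η + k + S‖ →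
      ‖dampedInv E l ε η - dampedInv E l ε (η + k)‖ ≤
        216 * ‖k‖ ^ d * twoPoleMajorant d S η := by
    intro η k h1 h2 h3 h4 hle
    have n1 := norm_pos_iff.2 h1
    have n2 := norm_pos_iff.2 h2
    have n3 := norm_pos_iff.2 h3
    have n4 := norm_pos_iff.2 h4
    have tri1 : ∀ w : ℂ, ‖S‖ ≤ ‖w‖ + ‖w + S‖ := fun w => by
      have := norm_sub_le (w + S) w; simp at this; linarith
    have tri2 : ∀ w : ℂ, ‖w + S‖ ≤ ‖w‖ + ‖S‖ := fun w => norm_add_le _ _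
    have tri3 : ∀ w : ℂ, ‖w‖ ≤ ‖w + S‖ + ‖S‖ := fun w => by
      have := norm_sub_le (w + S) S; simpa using this
    have tri1' := tri1 η
    have hxy : |‖η‖ - ‖η + k‖| ≤ ‖k‖ := by
      have := abs_norm_sub_norm_le η (η + k); simpa using this
    have hm : 0 < min ‖η‖ ‖η + S‖ := lt_min n1 n2
    have hm' : 0 < min ‖η + k‖ ‖η + k + S‖ := lt_min n3 n4
    have hsum : ‖S‖ ≤ min ‖η‖ ‖η + S‖ + max ‖η‖ ‖η + S‖ := by rw [min_add_max]; exact tri1'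
    have main := norm_damped_inv_sub_le (m := min ‖η‖ ‖η + S‖) (M := max ‖η‖ ‖η + S‖)
      (m' := min ‖η + k‖ ‖η + k + S‖) (M' := max ‖η + k‖ ‖η + k + S‖) (s := ‖S‖) (t := ‖k‖)
      (e := Real.exp (-(ε * ‖η‖ ^ 2))) (e' := Real.exp (-(ε * ‖η + k‖ ^ 2)))
      (P := symbol E l η) (P' := symbol E l (η + k)) hm (min_le_max) hm' min_le_max (norm_nonneg _)
      hsum
      (by
        have a1 := tri2 (η + k)
        have a2 := tri3 (η + k)
        rcases le_total ‖η + k‖ ‖η + k + S‖ with h | h <;> simp [h] <;> linarith)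
      (by rw [min_mul_max]; exact norm_mul_norm_add_pole_le E hl2 η)
      (by rw [min_mul_max]; exact norm_mul_norm_add_pole_le E hl2 (η + k))
      (by rw [min_mul_max, min_mul_max]; exact hle)
      ((norm_symbol_add_sub_le E l η k).trans (by
        gcongr
        · exact le_max_left _ _
        · exact le_max_left _ _))
      (Real.exp_pos _).le (Real.exp_le_one_iff.2 (by have := sq_nonneg ‖η‖; nlinarith))
      (Real.exp_pos _).le (Real.exp_le_one_iff.2 (by have := sq_nonneg ‖η + k‖; nlinarith))
      ((abs_exp_neg_sq_sub_le hε n1 n3 hxy).trans (by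
        gcongr
        · exact min_le_left _ _
        · exact min_le_left _ _))
    refine main.trans ?_
    have := min_one_div_le_majorant (t := ‖k‖) hm min_le_max (norm_nonneg k) hs0 hsum hd0 hd1
    rw [mul_div_assoc]
    calc _ ≤ 72 * (3 * ‖k‖ ^ d * majorant d ‖S‖ (min ‖η‖ ‖η + S‖)) := by gcongr
      _ ≤ 72 * (3 * ‖k‖ ^ d * twoPoleMajorant d S η) := by
        gcongr
        exact majorant_min_le hs0.le n1.le n2.le
      _ = _ := by ring
  have nn : ∀ η, 0 ≤ twoPoleMajorant d S η := fun η =>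
    add_nonneg (majorant_nonneg (norm_nonneg _) hs0.le) (majorant_nonneg (norm_nonneg _) hs0.le)
  -- `aux` must start at the endpoint with the smaller product of distances. If that is `ξ + h`, the
  -- step is `-h`.
  rcases le_total (‖ξ‖ * ‖ξ + S‖) (‖ξ + h‖ * ‖ξ + h + S‖) with hh | hh
  · refine (aux ξ h h1 h2 h3 h4 hh).trans ?_
    gcongr
    linarith [nn (ξ + h)]
  · have := aux (ξ + h) (-h) h3 h4 (by simpa using h1) (by simpa using h2) (by simpa using hh)
    rw [norm_sub_rev]
    simp only [add_neg_cancel_right, norm_neg] at this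
    refine this.trans ?_
    gcongr
    linarith [nn ξ]

/-! ### Integrability and scaling of the majorants -/

theorem measurable_majorant (d s : ℝ) : Measurable (majorant d s) := by
  unfold majorant; fun_prop

/-- In polar coordinates the density is `y ^ (-d) / (y + 1)`: `d < 1` gives integrability at zero
and `0 < d` at infinity. -/
theorem integrable_majorant_one {d : ℝ} (hd0 : 0 < d) (hd1 : d < 1) :
    Integrable (fun ξ : ℂ => majorant d 1 ‖ξ‖) := by
  rw [integrable_fun_norm_addHaar (volume : Measure ℂ) (f := majorant d 1),
    Complex.finrank_real_complex]
  have hm : Measurable fun y : ℝ => y ^ (2 - 1) • majorant d 1 y :=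
    (measurable_id.pow_const _).mul (measurable_majorant d 1)
  have hid : ∀ y : ℝ, 0 < y → y ^ (2 - 1) • majorant d 1 y = y ^ (-d) / (y + 1) := by
    intro y hy
    rw [majorant, show -1 - d = -d + -1 by ring, Real.rpow_add hy, Real.rpow_neg_one, smul_eq_mul]
    field_simp
    norm_num
  rw [← Set.Ioc_union_Ioi_eq_Ioi zero_le_one]
  refine IntegrableOn.union ?_ ?_
  · rw [integrableOn_Ioc_iff_integrableOn_Ioo]
    refine Integrable.mono' ((intervalIntegral.integrableOn_Ioo_rpow_iff one_pos).2
      (by linarith : -1 < -d)) hm.aestronglyMeasurable ?_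
    refine ae_restrict_of_forall_mem measurableSet_Ioo fun y hy => ?_
    have hy0 : 0 < y := hy.1
    rw [hid y hy0, Real.norm_of_nonneg (by positivity)]
    exact div_le_self (by positivity) (by linarith)
  · refine Integrable.mono' (integrableOn_Ioi_rpow_of_lt (by linarith : -d - 1 < -1) one_pos)
      hm.aestronglyMeasurable ?_
    refine ae_restrict_of_forall_mem measurableSet_Ioi fun y hy => ?_
    have hy0 : 0 < y := one_pos.trans hy
    rw [hid y hy0, Real.norm_of_nonneg (by positivity), Real.rpow_sub_one hy0.ne']
    gcongr
    linarith

theorem majorant_scale {d s : ℝ} (hs : 0 < s) {r : ℝ} (hr : 0 ≤ r) :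
    majorant d s r = s ^ (-2 - d) * majorant d 1 (s⁻¹ * r) := by
  rw [majorant, majorant, Real.mul_rpow (by positivity) hr, Real.inv_rpow hs.le,
    show -2 - d = (-1 - d) + -1 by ring, Real.rpow_add hs, Real.rpow_neg_one]
  have : 0 < s ^ (-1 - d) := by positivity
  have : r + s ≠ 0 := by positivity
  have : s⁻¹ * r + 1 ≠ 0 := by positivity
  field_simp

theorem integrable_majorant {d s : ℝ} (hd0 : 0 < d) (hd1 : d < 1) (hs : 0 < s) :
    Integrable (fun ξ : ℂ => majorant d s ‖ξ‖) ∧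
      ∫ ξ : ℂ, majorant d s ‖ξ‖ = s ^ (-d) * ∫ ξ : ℂ, majorant d 1 ‖ξ‖ := by
  have h : (fun ξ : ℂ => majorant d s ‖ξ‖)
      = fun ξ : ℂ => s ^ (-2 - d) * (fun η : ℂ => majorant d 1 ‖η‖) (s⁻¹ • ξ) := by
    funext ξ
    dsimp only
    rw [majorant_scale hs (norm_nonneg _), norm_smul, Real.norm_of_nonneg (by positivity)]
  rw [h]
  refine ⟨((integrable_majorant_one hd0 hd1).comp_smul (inv_ne_zero hs.ne')).const_mul _, ?_⟩
  rw [integral_const_mul, Measure.integral_comp_inv_smul_of_nonneg volume (fun η : ℂ => majorant d 1 ‖η‖) hs.le,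
    Complex.finrank_real_complex, smul_eq_mul, ← mul_assoc]
  congr 1
  rw [← Real.rpow_natCast, ← Real.rpow_add hs]
  congr 1; push_cast; ring

theorem integrable_twoPoleMajorant {d : ℝ} (hd0 : 0 < d) (hd1 : d < 1) {S : ℂ} (hS : S ≠ 0) :
    Integrable (twoPoleMajorant d S) ∧
      ∫ ξ : ℂ, twoPoleMajorant d S ξ = 2 * (‖S‖ ^ (-d) * ∫ ξ : ℂ, majorant d 1 ‖ξ‖) := by
  obtain ⟨h1, h2⟩ := integrable_majorant hd0 hd1 (norm_pos_iff.2 hS)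
  have h3 := h1.comp_add_right S
  refine ⟨h1.add h3, ?_⟩
  unfold twoPoleMajorant
  rw [integral_add h1 h3, integral_add_right_eq_self (fun ξ : ℂ => majorant d ‖S‖ ‖ξ‖) S, h2]
  ring

theorem continuous_symbol (E : ℝ) (l : ℂ) : Continuous (symbol E l) := by
  unfold symbol; fun_prop

theorem measurable_dampedInv (E : ℝ) (l : ℂ) (ε : ℝ) : Measurable (dampedInv E l ε) := by
  have := (continuous_symbol E l).measurable
  unfold dampedInv; fun_prop

theorem pole_ne_zero {E : ℝ} (hE : 0 < E) {l : ℂ} (hl : l ≠ 0) : pole E l ≠ 0 := by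
  have := norm_pos_iff.2 hl
  have := Real.sqrt_pos.2 hE
  rw [← norm_pos_iff, norm_pole E hl]; positivity

theorem integrable_dampedInv {E : ℝ} {l : ℂ} (hE : 0 < E) (hl : l ≠ 0)
    (hl2 : 1 + 1 / ‖l‖ ^ 2 ≤ 2 * |1 - 1 / ‖l‖ ^ 2|) {ε : ℝ} (hε : 0 < ε) :
    Integrable (dampedInv E l ε) := by
  have hS := pole_ne_zero hE hl
  refine Integrable.mono' ((integrable_twoPoleMajorant (d := 1 / 2) (by norm_num) (by norm_num)
    hS).1.const_mul (6 * (1 + 1 / ε))) (measurable_dampedInv E l ε).aestronglyMeasurable ?_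
  filter_upwards [Measure.ae_ne volume (0 : ℂ), Measure.ae_ne volume (-pole E l)] with ξ h1 h2
  have hx : 0 < ‖ξ‖ := norm_pos_iff.2 h1
  have hy : 0 < ‖ξ + pole E l‖ := norm_pos_iff.2 fun h => h2 (eq_neg_of_add_eq_zero_left h)
  have hs : 0 < ‖pole E l‖ := norm_pos_iff.2 hS
  have hP := norm_mul_norm_add_pole_le E hl2 ξ
  have hsum : ‖pole E l‖ ≤ ‖ξ‖ + ‖ξ + pole E l‖ := by
    have := norm_sub_le (ξ + pole E l) ξ; simp at this; linarith
  rw [dampedInv, norm_div, Complex.norm_real, Real.norm_of_nonneg (Real.exp_pos _).le]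
  set x := ‖ξ‖
  set y := ‖ξ + pole E l‖
  set s := ‖pole E l‖
  have hm : 0 < min x y := lt_min hx hy
  -- Taking `t` equal to the near distance turns `min 1 (t / m)` into `1`. The leftover square root
  -- of that distance is absorbed by the Gaussian in `hexp`.
  have hmaj := min_one_div_le_majorant (t := min x y) (d := 1 / 2) hm min_le_max hm.le hs
    (by rw [min_add_max]; exact hsum) (by norm_num) (by norm_num)
  rw [min_mul_max, div_self hm.ne', min_self] at hmaj
  have hmin := majorant_min_le (d := 1 / 2) hs.le hx.le hy.le
  have hexp : Real.exp (-(ε * x ^ 2)) * (min x y) ^ (1 / 2 : ℝ) ≤ 1 + 1 / ε := by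
    have e1 : (min x y) ^ (1 / 2 : ℝ) ≤ 1 + x ^ 2 := by
      calc (min x y) ^ (1 / 2 : ℝ) ≤ x ^ (1 / 2 : ℝ) := by gcongr; exact min_le_left _ _
        _ ≤ 1 + x ^ 2 := by
          rw [← Real.sqrt_eq_rpow]
          exact (Real.sqrt_le_left (by positivity)).2 (by nlinarith [sq_nonneg (x ^ 2), sq_nonneg (x - 1)])
    have e2 := Real.add_one_le_exp (ε * x ^ 2)
    rw [Real.exp_neg, inv_mul_le_iff₀ (Real.exp_pos _)]
    have e3 : (1 + x ^ 2) ≤ (ε * x ^ 2 + 1) * (1 + 1 / ε) := by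
      have : (ε * x ^ 2 + 1) * (1 + 1 / ε) = (1 + x ^ 2) + (ε * x ^ 2 + 1 / ε) := by
        field_simp; ring
      rw [this]
      have : 0 ≤ ε * x ^ 2 + 1 / ε := by positivity
      linarith
    refine e1.trans (e3.trans ?_)
    gcongr
  have hPi : Real.exp (-(ε * x ^ 2)) / ‖symbol E l ξ‖
      ≤ Real.exp (-(ε * x ^ 2)) * (2 * (1 / (x * y))) := by
    rw [div_eq_mul_one_div]
    gcongr
    have : 0 < x * y := by positivity
    rw [mul_one_div, div_le_div_iff₀ (by linarith) this]
    linarith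
  have hmaj0 := majorant_nonneg (d := 1 / 2) hm.le hs.le
  calc _ ≤ Real.exp (-(ε * x ^ 2)) * (2 * (1 / (x * y))) := hPi
    _ ≤ Real.exp (-(ε * x ^ 2)) * (2 * (3 * (min x y) ^ (1 / 2 : ℝ)
        * majorant (1 / 2) s (min x y))) := by gcongr
    _ = 6 * (Real.exp (-(ε * x ^ 2)) * (min x y) ^ (1 / 2 : ℝ))
        * majorant (1 / 2) s (min x y) := by ring
    _ ≤ 6 * (1 + 1 / ε) * majorant (1 / 2) s (min x y) := by gcongr
    _ ≤ 6 * (1 + 1 / ε) * twoPoleMajorant (1 / 2) (pole E l) ξ := by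
      gcongr
      exact hmin

/-! ### The half-period shift and the bound for the Green function -/

/-- The character `ξ ↦ exp(i ξ·x)`. -/
noncomputable def character (z ξ : ℂ) : ℂ :=
  Complex.exp (Complex.I * ((ξ.re * z.re + ξ.im * z.im : ℝ) : ℂ))

theorem norm_character (z ξ : ℂ) : ‖character z ξ‖ = 1 := by
  rw [character, mul_comm, Complex.norm_exp_ofReal_mul_I]

theorem continuous_character (z : ℂ) : Continuous (character z) := by
  unfold character; fun_prop

/-- Half a period in the direction of `z`. -/
noncomputable def halfPeriod (z : ℂ) : ℂ := ((Real.pi / ‖z‖ ^ 2 : ℝ) : ℂ) * z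

theorem norm_halfPeriod (z : ℂ) : ‖halfPeriod z‖ = Real.pi / ‖z‖ := by
  rw [halfPeriod, norm_mul, Complex.norm_real, Real.norm_of_nonneg (by positivity)]
  rcases eq_or_ne ‖z‖ 0 with h | h
  · simp [h]
  · field_simp

theorem character_add_halfPeriod {z : ℂ} (hz : z ≠ 0) (ξ : ℂ) :
    character z (ξ + halfPeriod z) = -character z ξ := by
  have h1 : (ξ + halfPeriod z).re * z.re + (ξ + halfPeriod z).im * z.im
      = (ξ.re * z.re + ξ.im * z.im) + Real.pi := by
    have h0 : ‖z‖ ^ 2 ≠ 0 := by simpa using hz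
    have h2 : ‖z‖ ^ 2 = z.re * z.re + z.im * z.im := by
      rw [Complex.sq_norm, Complex.normSq_apply]
    simp only [halfPeriod, Complex.add_re, Complex.add_im, Complex.re_ofReal_mul,
      Complex.im_ofReal_mul]
    have h3 : Real.pi / ‖z‖ ^ 2 * (z.re * z.re + z.im * z.im) = Real.pi := by
      rw [← h2]; field_simp
    linear_combination h3
  rw [character, h1, Complex.ofReal_add, mul_add, Complex.exp_add, mul_comm Complex.I (Real.pi : ℂ),
    Complex.exp_pi_mul_I, character]
  ring

theorem greenMean_eq_integral_sub {E : ℝ} {l : ℂ} (hE : 0 < E) (hl : l ≠ 0)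
    (hl2 : 1 + 1 / ‖l‖ ^ 2 ≤ 2 * |1 - 1 / ‖l‖ ^ 2|) {ε : ℝ} (hε : 0 < ε) {z : ℂ} (hz : z ≠ 0) :
    greenMean E l ε z = -(1 / (2 * (Real.pi : ℂ)) ^ 2) * (1 / 2 *
      ∫ ξ : ℂ, character z ξ * (dampedInv E l ε ξ - dampedInv E l ε (ξ + halfPeriod z))) := by
  have hi := integrable_dampedInv hE hl hl2 hε
  have hint : ∀ F : ℂ → ℂ, Integrable F → Integrable fun ξ => character z ξ * F ξ := fun F hF =>
    hF.bdd_mul (c := 1) (continuous_character z).aestronglyMeasurable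
      (Eventually.of_forall fun ξ => (norm_character z ξ).le)
  have h1 := hint _ hi
  have h2 := hint _ (hi.comp_add_right (halfPeriod z))
  have h3 : ∫ ξ : ℂ, character z ξ * dampedInv E l ε (ξ + halfPeriod z)
      = -∫ ξ : ℂ, character z ξ * dampedInv E l ε ξ := by
    rw [← integral_add_right_eq_self (fun ξ => character z ξ * dampedInv E l ε ξ) (halfPeriod z),
      ← integral_neg]
    congr 1 with ξ
    rw [character_add_halfPeriod hz]; ring
  have h4 : ∫ ξ : ℂ, character z ξ * (dampedInv E l ε ξ - dampedInv E l ε (ξ + halfPeriod z))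
      = 2 * ∫ ξ : ℂ, character z ξ * dampedInv E l ε ξ := by
    simp only [mul_sub]
    rw [integral_sub h1 h2, h3]; ring
  rw [h4, greenMean]
  congr 1
  rw [← mul_assoc, one_div_mul_cancel two_ne_zero, one_mul]
  congr 1 with ξ
  rw [dampedInv, ← Complex.ofReal_neg, ← Complex.ofReal_exp, character]
  ring

theorem ae_norm_dampedInv_sub_le {E : ℝ} {l : ℂ} (hE : 0 < E) (hl : l ≠ 0)
    (hl2 : 1 + 1 / ‖l‖ ^ 2 ≤ 2 * |1 - 1 / ‖l‖ ^ 2|) {ε d : ℝ} (hε : 0 ≤ ε) (hd0 : 0 < d)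
    (hd1 : d ≤ 1) (h z : ℂ) :
    ∀ᵐ ξ : ℂ, ‖character z ξ * (dampedInv E l ε ξ - dampedInv E l ε (ξ + h))‖ ≤
      216 * ‖h‖ ^ d * (twoPoleMajorant d (pole E l) ξ + twoPoleMajorant d (pole E l) (ξ + h)) := by
  filter_upwards [Measure.ae_ne volume (0 : ℂ), Measure.ae_ne volume (-pole E l),
    Measure.ae_ne volume (-h), Measure.ae_ne volume (-(h + pole E l))] with ξ h1 h2 h3 h4
  rw [norm_mul, norm_character, one_mul]
  exact norm_dampedInv_sub_le hE hl hl2 hε hd0 hd1 h1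
    (fun h' => h2 (eq_neg_of_add_eq_zero_left h'))
    (fun h' => h3 (eq_neg_of_add_eq_zero_left h'))
    (fun h' => h4 (eq_neg_of_add_eq_zero_left (by rwa [add_assoc] at h')))

/-- `g` is a `limUnder`, so it carries information only once a limit is known to exist. After the
half-period shift the integrands have an integrable majorant independent of `ε`, and dominated
convergence applies. -/
theorem tendsto_greenMean {E : ℝ} {l : ℂ} (hE : 0 < E) (hl : l ≠ 0)
    (hl2 : 1 + 1 / ‖l‖ ^ 2 ≤ 2 * |1 - 1 / ‖l‖ ^ 2|) {z : ℂ} (hz : z ≠ 0) :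
    Tendsto (fun ε => greenMean E l ε z) (𝓝[>] 0) (𝓝 (g E l z)) := by
  -- The increment form still makes sense at `ε = 0`, where the undamped reciprocal is not
  -- absolutely integrable.
  refine tendsto_nhds_limUnder ⟨-(1 / (2 * (Real.pi : ℂ)) ^ 2) * (1 / 2 *
      ∫ ξ : ℂ, character z ξ * (dampedInv E l 0 ξ - dampedInv E l 0 (ξ + halfPeriod z))), ?_⟩
  have hmeas : ∀ ε, Measurable fun ξ => character z ξ *
      (dampedInv E l ε ξ - dampedInv E l ε (ξ + halfPeriod z)) := fun ε =>
    (continuous_character z).measurable.mul ((measurable_dampedInv E l ε).sub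
      ((measurable_dampedInv E l ε).comp (measurable_add_const _)))
  have hN := (integrable_twoPoleMajorant (d := 1 / 2) (by norm_num) (by norm_num)
    (pole_ne_zero hE hl)).1
  have key : Tendsto (fun ε : ℝ => ∫ ξ : ℂ, character z ξ *
      (dampedInv E l ε ξ - dampedInv E l ε (ξ + halfPeriod z))) (𝓝[>] 0)
      (𝓝 (∫ ξ : ℂ, character z ξ *
        (dampedInv E l 0 ξ - dampedInv E l 0 (ξ + halfPeriod z)))) := by
    refine tendsto_integral_filter_of_dominated_convergence _
      (Eventually.of_forall fun ε => (hmeas ε).aestronglyMeasurable) ?_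
      ((hN.add (hN.comp_add_right (halfPeriod z))).const_mul (216 * ‖halfPeriod z‖ ^ (1 / 2 : ℝ)))
      (Eventually.of_forall fun ξ => ?_)
    · filter_upwards [self_mem_nhdsWithin] with ε hε
      exact ae_norm_dampedInv_sub_le hE hl hl2 (le_of_lt hε) (by norm_num) (by norm_num) _ _
    · have hc : ∀ η, Tendsto (fun ε => dampedInv E l ε η) (𝓝[>] 0) (𝓝 (dampedInv E l 0 η)) := by
        intro η
        have : Continuous fun ε => dampedInv E l ε η := by
          unfold dampedInv
          fun_prop
        exact this.continuousAt.tendsto.mono_left nhdsWithin_le_nhds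
      exact ((hc _).sub (hc _)).const_mul _
  refine ((key.const_mul _).const_mul _).congr' ?_
  filter_upwards [self_mem_nhdsWithin] with ε hε
  exact (greenMean_eq_integral_sub hE hl hl2 hε hz).symm

/-- The shift contributes `(π / ‖z‖) ^ d` and the scaling of the majorant contributes `‖pole E l‖ ^
(-d)`. The bound holds for every Gauss mean, hence for the limit. `C` depends on `d` alone. -/
theorem norm_g_le {d : ℝ} (hd0 : 0 < d) (hd1 : d < 1) :
    ∃ C : ℝ, 0 ≤ C ∧ ∀ (E : ℝ) (l z : ℂ), 0 < E → l ≠ 0 →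
      1 + 1 / ‖l‖ ^ 2 ≤ 2 * |1 - 1 / ‖l‖ ^ 2| → z ≠ 0 →
      ‖g E l z‖ ≤ C * ‖pole E l‖ ^ (-d) * ‖z‖ ^ (-d) := by
  have hJ : 0 ≤ ∫ ξ : ℂ, majorant d 1 ‖ξ‖ :=
    integral_nonneg fun ξ => majorant_nonneg (norm_nonneg _) zero_le_one
  refine ⟨‖-(1 / (2 * (Real.pi : ℂ)) ^ 2)‖ * (1 / 2 *
    (216 * Real.pi ^ d * (4 * ∫ ξ : ℂ, majorant d 1 ‖ξ‖))), by positivity, ?_⟩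
  intro E l z hE hl hl2 hz
  refine le_of_tendsto (tendsto_greenMean hE hl hl2 hz).norm ?_
  filter_upwards [self_mem_nhdsWithin] with ε hε
  obtain ⟨hN, hNi⟩ := integrable_twoPoleMajorant hd0 hd1 (pole_ne_zero hE hl)
  rw [greenMean_eq_integral_sub hE hl hl2 hε hz, norm_mul, norm_mul, show ‖(1 / 2 : ℂ)‖ = 1 / 2 by simp]
  have hb := norm_integral_le_of_norm_le
    ((hN.add (hN.comp_add_right (halfPeriod z))).const_mul (216 * ‖halfPeriod z‖ ^ d))
    (ae_norm_dampedInv_sub_le hE hl hl2 (le_of_lt hε) hd0 hd1.le (halfPeriod z) z)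
  have hval : ∫ ξ : ℂ, 216 * ‖halfPeriod z‖ ^ d * (twoPoleMajorant d (pole E l) ξ
      + twoPoleMajorant d (pole E l) (ξ + halfPeriod z))
      = 216 * Real.pi ^ d * (4 * ∫ ξ : ℂ, majorant d 1 ‖ξ‖) * ‖pole E l‖ ^ (-d) * ‖z‖ ^ (-d) := by
    rw [integral_const_mul, integral_add hN (hN.comp_add_right _), integral_add_right_eq_self,
      hNi, norm_halfPeriod, Real.div_rpow Real.pi_pos.le (norm_nonneg _), Real.rpow_neg (norm_nonneg z)]
    ring
  refine (mul_le_mul_of_nonneg_left (mul_le_mul_of_nonneg_left (hb.trans hval.le) (by norm_num))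
    (norm_nonneg _)).trans (le_of_eq ?_)
  ring

theorem measurable_greenMean (E : ℝ) (l : ℂ) (ε : ℝ) : StronglyMeasurable (greenMean E l ε) := by
  have hs := (continuous_symbol E l).measurable
  have h : Measurable (Function.uncurry fun z ξ : ℂ => Complex.exp (-((ε * ‖ξ‖ ^ 2 : ℝ) : ℂ)) *
      (Complex.exp (Complex.I * ((ξ.re * z.re + ξ.im * z.im : ℝ) : ℂ)) / symbol E l ξ)) := by
    unfold Function.uncurry
    fun_prop
  exact (h.stronglyMeasurable.integral_prod_right (ν := (volume : Measure ℂ))).const_mul _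

theorem aestronglyMeasurable_g {E : ℝ} {l : ℂ} (hE : 0 < E) (hl : l ≠ 0)
    (hl2 : 1 + 1 / ‖l‖ ^ 2 ≤ 2 * |1 - 1 / ‖l‖ ^ 2|) : AEStronglyMeasurable (g E l) := by
  refine aestronglyMeasurable_of_tendsto_ae (𝓝[>] (0 : ℝ))
    (fun ε => (measurable_greenMean E l ε).aestronglyMeasurable) ?_
  filter_upwards [Measure.ae_ne volume (0 : ℂ)] with z hz
  exact tendsto_greenMean hE hl hl2 hz

/-! ### Weak singularities tested against `L^p` functions -/

theorem memLp_indicator_ball_norm_rpow {q : ℝ≥0∞} (hq0 : q ≠ 0) (hqt : q ≠ ∞) {d : ℝ}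
    (hd : d * q.toReal < 2) :
    MemLp ((Metric.ball (0 : ℂ) 1).indicator fun w => ‖w‖ ^ (-d)) q := by
  have hm : Measurable fun w : ℂ => ‖w‖ ^ (-d) := by fun_prop
  rw [memLp_indicator_iff_restrict Metric.isOpen_ball.measurableSet,
    ← integrable_norm_rpow_iff hm.aestronglyMeasurable hq0 hqt]
  refine integrableOn_ball_of_norm_le_rpow (C := 1) (α := d * q.toReal)
    (by rw [Complex.finrank_real_complex]; norm_num)
    (by rw [Complex.finrank_real_complex]; exact_mod_cast hd)
    (Eventually.of_forall fun w => ?_) (hm.norm.pow_const _).aestronglyMeasurable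
  rw [one_mul, Real.norm_of_nonneg (by positivity), Real.norm_of_nonneg (by positivity),
    ← Real.rpow_mul (norm_nonneg _), neg_mul]

/-- On the disc the singularity is at most `1` where `‖z - w‖ ≥ 1`, and elsewhere it is a translate
of the fixed function supported in the unit ball. Translation invariance then removes both `z` and
`c`. -/
theorem eLpNorm_indicator_closedBall_norm_rpow_le {q : ℝ≥0∞} (hq1 : 1 ≤ q) (hqt : q ≠ ∞) {d : ℝ}
    (hd0 : 0 ≤ d) (hd : d * q.toReal < 2) (c z : ℂ) (R : ℝ) :
    eLpNorm ((Metric.closedBall c R).indicator fun w => ‖z - w‖ ^ (-d)) q ≤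
      volume (Metric.closedBall (0 : ℂ) R) ^ (1 / q.toReal) +
        eLpNorm ((Metric.ball (0 : ℂ) 1).indicator fun w => ‖w‖ ^ (-d)) q := by
  have hq0 : q ≠ 0 := (one_pos.trans_le hq1).ne'
  have hφm := (memLp_indicator_ball_norm_rpow hq0 hqt hd).1
  have hBm : MeasurableSet (Metric.closedBall c R) := Metric.isClosed_closedBall.measurableSet
  have hmp : MeasurePreserving (fun w : ℂ => z - w) := Measure.measurePreserving_sub_left volume z
  generalize hφ : (Metric.ball (0 : ℂ) 1).indicator (fun w => ‖w‖ ^ (-d)) = φ at hφm ⊢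
  rw [← eLpNorm_comp_measurePreserving hφm hmp, ← Measure.addHaar_closedBall_center volume c]
  generalize hB : Metric.closedBall c R = B at hBm ⊢
  have hone : volume B ^ (1 / q.toReal) = eLpNorm (B.indicator fun _ => (1 : ℝ)) q := by
    rw [eLpNorm_indicator_const hBm hq0 hqt]; simp
  rw [hone]
  refine le_trans (eLpNorm_mono_real fun w => ?_)
    (eLpNorm_add_le ((measurable_const.indicator hBm).aestronglyMeasurable)
      (hφm.comp_measurePreserving hmp) hq1)
  have hnn : 0 ≤ ‖z - w‖ ^ (-d) := by positivity
  have hφ0 : ∀ u, 0 ≤ φ u := fun u => by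
    rw [← hφ]; exact Set.indicator_nonneg (fun _ _ => by positivity) _
  rw [Pi.add_apply, Function.comp_apply]
  by_cases hw : w ∈ B
  · rw [Set.indicator_of_mem hw, Set.indicator_of_mem hw, Real.norm_of_nonneg hnn]
    by_cases hw1 : z - w ∈ Metric.ball (0 : ℂ) 1
    · rw [← hφ, Set.indicator_of_mem hw1]; linarith
    · refine le_add_of_le_of_nonneg ?_ (hφ0 _)
      exact Real.rpow_le_one_of_one_le_of_nonpos (by simpa using hw1) (by linarith)
  · rw [Set.indicator_of_notMem hw, Set.indicator_of_notMem hw, norm_zero, zero_add]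
    exact hφ0 _

/-- Local integrability of a weak singularity against `L^p` functions supported in a disc,
uniformly in the centres. -/
theorem lintegral_norm_rpow_mul_le {p : ℝ≥0∞} (hp : 1 < p) :
    ∃ d : ℝ, 0 < d ∧ d < 1 ∧ ∀ R : ℝ, ∃ C : ℝ≥0∞, C ≠ ∞ ∧ ∀ (v : ℂ → ℂ) (c z : ℂ),
      AEStronglyMeasurable v → (∀ᵐ w : ℂ, w ∉ Metric.closedBall c R → v w = 0) →
      ∫⁻ w : ℂ, ‖‖z - w‖ ^ (-d)‖ₑ * ‖v w‖ₑ ≤ C * eLpNorm v p := by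
  have hpq : p.HolderConjugate p.conjExponent := .conjExponent hp.le
  generalize p.conjExponent = q at hpq
  have hqp : q.HolderConjugate p := hpq.symm
  have hqt : q ≠ ∞ := ((ENNReal.HolderConjugate.lt_top_iff_one_lt q p).2 hp).ne
  have hq1 : 1 ≤ q := ENNReal.HolderConjugate.one_le q p
  have hqr : 1 ≤ q.toReal := by simpa using ENNReal.toReal_mono hqt hq1
  -- With `d = 1 / (2 * q)` one has `d * q = 1 / 2`. Finiteness of `q`, which makes `d` positive, is
  -- where `1 < p` enters.
  obtain ⟨d, hd0, hd1, hdq⟩ : ∃ d : ℝ, 0 < d ∧ d < 1 ∧ d * q.toReal < 2 := by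
    refine ⟨1 / (2 * q.toReal), by positivity, ?_, ?_⟩
    · rw [div_lt_one (by positivity)]; linarith
    · field_simp; norm_num
  refine ⟨d, hd0, hd1, fun R => ?_⟩
  have hfin : volume (Metric.closedBall (0 : ℂ) R) ^ (1 / q.toReal) +
      eLpNorm ((Metric.ball (0 : ℂ) 1).indicator fun w => ‖w‖ ^ (-d)) q ≠ ∞ := by
    have h1 : volume (Metric.closedBall (0 : ℂ) R) ≠ ∞ := measure_closedBall_lt_top.ne
    have h2 : 0 ≤ 1 / q.toReal := one_div_nonneg.2 (zero_le_one.trans hqr)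
    exact ENNReal.add_ne_top.2 ⟨ENNReal.rpow_ne_top_of_nonneg h2 h1,
      (memLp_indicator_ball_norm_rpow (one_pos.trans_le hq1).ne' hqt hdq).2.ne⟩
  refine ⟨_, hfin, ?_⟩
  intro v c z hv hsupp
  refine le_trans ?_ (mul_le_mul_left
    (eLpNorm_indicator_closedBall_norm_rpow_le hq1 hqt hd0.le hdq c z R) _)
  have hfm : AEStronglyMeasurable ((Metric.closedBall c R).indicator fun w => ‖z - w‖ ^ (-d)) := by
    have : Measurable fun w : ℂ => ‖z - w‖ ^ (-d) := by fun_prop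
    exact (this.indicator Metric.isClosed_closedBall.measurableSet).aestronglyMeasurable
  refine le_trans (le_of_eq ?_) (eLpNorm_smul_le_mul_eLpNorm (r := 1) hv hfm)
  rw [eLpNorm_one_eq_lintegral_enorm]
  refine lintegral_congr_ae ?_
  filter_upwards [hsupp] with w hw
  rw [Pi.smul_apply', enorm_smul]
  by_cases hwB : w ∈ Metric.closedBall c R
  · rw [Set.indicator_of_mem hwB]
  · rw [hw hwB]; simp

/-! ### Contraction in `L^∞` and the choice of the ring -/

/-- Unique solvability in `L^∞` of an integral equation with a small kernel. -/
theorem existsUnique_integral_equation {G v : ℂ → ℂ} (hG : AEStronglyMeasurable G)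
    (hv : AEStronglyMeasurable v)
    (hsmall : ∀ z : ℂ, ∫⁻ w : ℂ, ‖G (z - w) * v w‖ₑ ≤ ENNReal.ofReal (1 / 2)) :
    ∃! μ : Lp ℂ ∞ (volume : Measure ℂ), ∀ᵐ z : ℂ,
      Integrable (fun w : ℂ => G (z - w) * v w * μ w) ∧
        μ z = 1 + ∫ w : ℂ, G (z - w) * v w * μ w := by
  have hGz : ∀ z, AEStronglyMeasurable (fun w => G (z - w)) := fun z =>
    hG.comp_quasiMeasurePreserving (quasiMeasurePreserving_sub_left volume z)
  have hK : ∀ z, Integrable (fun w => G (z - w) * v w) := fun z =>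
    ⟨(hGz z).mul hv, (hsmall z).trans_lt ENNReal.ofReal_lt_top⟩
  have hKn : ∀ z, ∫ w, ‖G (z - w) * v w‖ ≤ 1 / 2 := fun z => by
    rw [integral_norm_eq_lintegral_enorm (hK z).1]
    exact ENNReal.toReal_le_of_le_ofReal (by norm_num) (hsmall z)
  have hbd : ∀ μ : Lp ℂ ∞ (volume : Measure ℂ), ∀ᵐ w, ‖μ w‖ ≤ ‖μ‖ := fun μ => by
    filter_upwards [ae_le_eLpNormEssSup (f := μ) (μ := volume)] with w hw
    rw [Lp.norm_def, eLpNorm_exponent_top, ← toReal_enorm]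
    refine ENNReal.toReal_mono ?_ hw
    rw [← eLpNorm_exponent_top]; exact Lp.eLpNorm_ne_top μ
  have hint : ∀ (μ : Lp ℂ ∞ (volume : Measure ℂ)) z,
      Integrable (fun w => G (z - w) * v w * μ w) := fun μ z =>
    (hK z).mul_bdd (Lp.aestronglyMeasurable μ) (hbd μ)
  have hle : ∀ (μ : Lp ℂ ∞ (volume : Measure ℂ)) z,
      ‖∫ w, G (z - w) * v w * μ w‖ ≤ 1 / 2 * ‖μ‖ := fun μ z => by
    calc _ ≤ ∫ w, ‖G (z - w) * v w‖ * ‖μ‖ := by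
          refine norm_integral_le_of_norm_le ((hK z).norm.mul_const _) ?_
          filter_upwards [hbd μ] with w hw
          rw [norm_mul (G (z - w) * v w)]
          gcongr
      _ = (∫ w, ‖G (z - w) * v w‖) * ‖μ‖ := integral_mul_const _ _
      _ ≤ _ := by gcongr; exact hKn z
  have hmeas : ∀ μ : Lp ℂ ∞ (volume : Measure ℂ),
      AEStronglyMeasurable fun z => 1 + ∫ w, G (z - w) * v w * μ w := fun μ => by
    -- The integral is the convolution of `v * μ` with `G`, so Fubini gives measurability in `z`.
    have h1 := ((hv.mul (Lp.aestronglyMeasurable μ)).convolution_integrand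
      (ContinuousLinearMap.mul ℂ ℂ) (μ := volume) hG).integral_prod_right'
    refine aestronglyMeasurable_const.add (h1.congr (Eventually.of_forall fun z => ?_))
    refine integral_congr_ae (Eventually.of_forall fun w => ?_)
    simp only [ContinuousLinearMap.mul_apply', Pi.mul_apply]
    ring
  have hmem : ∀ μ : Lp ℂ ∞ (volume : Measure ℂ),
      MemLp (fun z => 1 + ∫ w, G (z - w) * v w * μ w) ∞ := fun μ =>
    memLp_top_of_bound (hmeas μ) (1 + 1 / 2 * ‖μ‖) (Eventually.of_forall fun z =>
      (norm_add_le _ _).trans (by rw [norm_one]; gcongr; exact hle μ z))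
  let Φ : Lp ℂ ∞ (volume : Measure ℂ) → Lp ℂ ∞ (volume : Measure ℂ) := fun μ => (hmem μ).toLp _
  have hΦ : ContractingWith (1 / 2) Φ := by
    refine ⟨by rw [← NNReal.coe_lt_coe]; norm_num, LipschitzWith.of_dist_le_mul fun μ ν => ?_⟩
    rw [dist_eq_norm, dist_eq_norm, ← MemLp.toLp_sub, Lp.norm_toLp]
    have hsub : ∀ z, ‖(1 + ∫ w, G (z - w) * v w * μ w) - (1 + ∫ w, G (z - w) * v w * ν w)‖
        ≤ 1 / 2 * ‖μ - ν‖ := fun z => by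
      rw [add_sub_add_left_eq_sub, ← integral_sub (hint μ z) (hint ν z)]
      refine le_of_eq_of_le (congrArg _ (integral_congr_ae ?_)) (hle (μ - ν) z)
      filter_upwards [Lp.coeFn_sub μ ν] with w hw
      rw [hw, Pi.sub_apply]; ring
    refine ENNReal.toReal_le_of_le_ofReal (by positivity) ?_
    rw [eLpNorm_exponent_top]
    refine eLpNormEssSup_le_of_ae_bound (Eventually.of_forall fun z => ?_)
    simpa using hsub z
  -- The integrability clause holds for every `μ` by `hint`, so being a solution reduces to the
  -- fixed-point identity.
  have hiff : ∀ μ : Lp ℂ ∞ (volume : Measure ℂ), (∀ᵐ z : ℂ,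
      Integrable (fun w : ℂ => G (z - w) * v w * μ w) ∧
        μ z = 1 + ∫ w : ℂ, G (z - w) * v w * μ w) ↔ Function.IsFixedPt Φ μ := fun μ => by
    constructor
    · intro h
      refine Lp.ext ((MemLp.coeFn_toLp (hmem μ)).trans ?_)
      filter_upwards [h] with z hz using hz.2.symm
    · intro h
      have h1 := MemLp.coeFn_toLp (hmem μ)
      rw [show (hmem μ).toLp _ = μ from h] at h1
      filter_upwards [h1] with z hz using ⟨hint μ z, hz⟩
  refine ⟨ContractingWith.fixedPoint Φ hΦ, (hiff _).2 hΦ.fixedPoint_isFixedPt, fun ν hν => ?_⟩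
  exact hΦ.fixedPoint_unique ((hiff ν).1 hν)

theorem not_isExceptional_of_small {E : ℝ} (hE : 0 < E) {v : ℂ → ℂ} (hv : AEStronglyMeasurable v)
    {l : ℂ} (hl2 : 1 + 1 / ‖l‖ ^ 2 ≤ 2 * |1 - 1 / ‖l‖ ^ 2|)
    (hsmall : ∀ z : ℂ, ∫⁻ w : ℂ, ‖g E l (z - w) * v w‖ₑ ≤ ENNReal.ofReal (1 / 2)) :
    ¬ IsExceptional E v l := fun ⟨hl, _, h⟩ =>
  h (existsUnique_integral_equation (aestronglyMeasurable_g hE hl hl2) hv hsmall)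

theorem one_add_le_of_le_norm {A : ℝ} (hA : 2 ≤ A) {l : ℂ} (hl : l ≠ 0)
    (h : ‖l‖ ≤ A⁻¹ ∨ A ≤ ‖l‖) :
    1 + 1 / ‖l‖ ^ 2 ≤ 2 * |1 - 1 / ‖l‖ ^ 2| ∧ A ≤ ‖l‖ + 1 / ‖l‖ := by
  have hl0 : 0 < ‖l‖ := norm_pos_iff.2 hl
  rcases h with h | h
  · have h1 : A ≤ 1 / ‖l‖ := by
      rw [one_div]; exact (le_inv_comm₀ hl0 (by linarith)).1 h
    rw [← one_div_pow]
    refine ⟨?_, by linarith⟩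
    have : 1 - (1 / ‖l‖) ^ 2 ≤ 0 := by nlinarith
    rw [abs_of_nonpos this]; nlinarith
  · have h1 : 1 / ‖l‖ ≤ 1 / 2 := one_div_le_one_div_of_le two_pos (hA.trans h)
    have h0 : 0 < 1 / ‖l‖ := by positivity
    rw [← one_div_pow]
    refine ⟨?_, by linarith⟩
    have : 0 ≤ 1 - (1 / ‖l‖) ^ 2 := by nlinarith
    rw [abs_of_nonneg this]; nlinarith

end Faddeev

theorem lemma2p1 (E : ℝ) (hE : 0 < E) (p : ℝ≥0∞) (hp : 1 < p) (M R : ℝ) :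
    ∃ A : ℝ, 1 < A ∧
      ∀ (v : ℂ → ℂ) (c : ℂ), MemLp v p volume → eLpNorm v p volume ≤ ENNReal.ofReal M →
        (∀ᵐ z : ℂ, z ∉ Metric.closedBall c R → v z = 0) →
        ∀ l : ℂ, Faddeev.IsExceptional E v l → A⁻¹ < ‖l‖ ∧ ‖l‖ < A := by
  obtain ⟨d, hd0, hd1, hker⟩ := Faddeev.lintegral_norm_rpow_mul_le hp
  obtain ⟨C₁, hC₁, hg⟩ := Faddeev.norm_g_le hd0 hd1
  obtain ⟨C₂, hC₂, hker⟩ := hker R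
  have hsE : 0 < Real.sqrt E := Real.sqrt_pos.2 hE
  have hlim : Tendsto (fun A : ℝ => ENNReal.ofReal (C₁ * (Real.sqrt E * A) ^ (-d))
      * (C₂ * ENNReal.ofReal M)) atTop (𝓝 0) := by
    have h1 : Tendsto (fun A : ℝ => C₁ * (Real.sqrt E * A) ^ (-d)) atTop (𝓝 (C₁ * 0)) :=
      ((tendsto_rpow_neg_atTop hd0).comp (tendsto_id.const_mul_atTop hsE)).const_mul C₁
    have h2 := ENNReal.Tendsto.mul_const (b := C₂ * ENNReal.ofReal M) (ENNReal.tendsto_ofReal h1)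
      (Or.inr (ENNReal.mul_ne_top hC₂ ENNReal.ofReal_ne_top))
    simpa using h2
  -- Largeness of `A` makes the kernel bound at most `1 / 2`, and `A ≥ 2` secures the lower bound
  -- for the symbol outside the ring.
  obtain ⟨A, hA, hA2⟩ := ((hlim.eventually_le_const
    (ENNReal.ofReal_pos.2 (by norm_num : (0 : ℝ) < 1 / 2))).and (eventually_ge_atTop 2)).exists
  refine ⟨A, by linarith, fun v c hv hvM hsupp l hexc => ?_⟩
  by_contra hcon
  have hor : ‖l‖ ≤ A⁻¹ ∨ A ≤ ‖l‖ := by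
    by_contra! h
    exact hcon h
  obtain ⟨hl2, hAl⟩ := Faddeev.one_add_le_of_le_norm hA2 hexc.1 hor
  refine Faddeev.not_isExceptional_of_small hE hv.1 hl2 (fun z => ?_) hexc
  have hA0 : 0 < A := by linarith
  have hS : ‖Faddeev.pole E l‖ ^ (-d) ≤ (Real.sqrt E * A) ^ (-d) := by
    rw [Faddeev.norm_pole E hexc.1]
    exact Real.rpow_le_rpow_of_nonpos (by positivity) (by gcongr) (by linarith)
  calc ∫⁻ w : ℂ, ‖Faddeev.g E l (z - w) * v w‖ₑ
      ≤ ∫⁻ w : ℂ, ENNReal.ofReal (C₁ * (Real.sqrt E * A) ^ (-d))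
          * (‖‖z - w‖ ^ (-d)‖ₑ * ‖v w‖ₑ) := by
        refine lintegral_mono_ae ?_
        -- The bound for `g` is available only off the origin, so the null set `w = z` is discarded.
        filter_upwards [Measure.ae_ne volume z] with w hw
        rw [enorm_mul, ← mul_assoc]
        gcongr
        have h1 : (0 : ℝ) ≤ ‖z - w‖ ^ (-d) := by positivity
        rw [Real.enorm_of_nonneg h1, ← ENNReal.ofReal_mul (by positivity), ← ofReal_norm]
        refine ENNReal.ofReal_le_ofReal ((hg E l (z - w) hE hexc.1 hl2
          (sub_ne_zero.2 (Ne.symm hw))).trans ?_)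
        gcongr
    _ = ENNReal.ofReal (C₁ * (Real.sqrt E * A) ^ (-d))
          * ∫⁻ w : ℂ, ‖‖z - w‖ ^ (-d)‖ₑ * ‖v w‖ₑ :=
        lintegral_const_mul' _ _ ENNReal.ofReal_ne_top
    _ ≤ ENNReal.ofReal (C₁ * (Real.sqrt E * A) ^ (-d)) * (C₂ * ENNReal.ofReal M) := by
        gcongr
        exact (hker v c z hv.1 hsupp).trans (by gcongr)
    _ ≤ _ := hA
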